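/- Let $d,r\ge 1$ be integers. For $n\ge 0$ and a finite group $G$, a $G$-prepartition of $[n]=\{1,\dots,n\}$ is a triple $(I,\pi,\gamma)$ with $I\subseteq[n]$ (the zero block, possibly empty), $\pi$ a partition of $[n]\setminus I$ into nonempty blocks, and $\gamma:[n]\setminus I\to G$ a labelling. Two prepartitions are equivalent if they have the same $I$ and the same $\pi$ and, for each block $B\in\pi$, the two labellings of $B$ differ by right multiplication by an element of $G$. The Dowling lattice $Q_n(G)$ is the set of equivalence classes, with the partial order generated by the moves: (a) merge a nonzero block into $I$; (b) replace two nonzero blocks $(B,\gamma|_B)$, $(C,\gamma|_C)$ by one block $B\cup C$ labelled by $\gamma$ on $B$ and by $\gamma\cdot g$ on $C$, for some $g\in G$. Its minimum $\hat 0$ has $I=\emptyset$ and all blocks singletons; its maximum $\hat 1$ has $I=[n]$. For $n\ge1$, let $Q_{dn}(dr,d,d,\{0\})$ be the subposet of $Q_{dn}(\mathbb{Z}/dr\mathbb{Z})$ consisting of $\hat 0$ together with all classes of $(I,\pi,\gamma)$ such that $I\neq\emptyset$ and, for every block $B\in\pi$, $d$ divides $|B|$ and the number $|\{a\in B:\gamma(a)\equiv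 j \pmod d\}|$ does not depend on $j$. Write $\mu(P)=\mu_P(\hat 0,\hat 1)$ for the Möbius function of a finite bounded poset $P$. Then, as formal power series in $x$ over $\mathbb{Q}$, $$\sum_{n\ge 1}\mu\bigl(Q_{dn}(dr,d,d,\{0\})\bigr)\,\frac{d^n x^n}{(dn)!\,r^{(d-1)n}} \;=\; -\left(\sum_{n\ge 1}\frac{d^n x^n}{(dn)!\,r^{(d-1)n}}\right)\left(\sum_{n\ge 0}\frac{d^n r^n x^n}{(n!)^{d}}\right)^{-\frac{1}{dr}},$$ where $f^{\alpha}=\sum_{k\ge0}\binom{\alpha}{k}(f-1)^k$ for a power series $f$ with constant term $1$ and $\alpha\in\mathbb{Q}$. -/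

import Mathlib

open scoped Nat PowerSeries

namespace Dowling

/-- A `G`-prepartition `(I, π, γ)` of `[n]`: a zero block `I ⊆ [n]`, a partition `π` of `[n] \ I`
into nonempty blocks, and a labelling `γ` of the elements of `[n] \ I` by elements of `G`.
(The values of `label` on the zero block carry no information; `Equivalent` ignores them.) -/
structure GPrepartition (n : ℕ) (G : Type) where
  zero : Finset (Fin n)
  blocks : Finpartition zeroᶜ
  label : Fin n → G

variable {n : ℕ} {G : Type} [Group G]

/-- Two `G`-prepartitions are equivalent if they have the same zero block and their nonzero
labelled blocks correspond to each other up to the right action of `G`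
(`{(a, γ' a) | a ∈ B} = {(a, γ a) | a ∈ B} · g`); corresponding blocks then have the same
underlying set. -/
def Equivalent (p q : GPrepartition n G) : Prop :=
  p.zero = q.zero ∧ p.blocks.parts = q.blocks.parts ∧
    ∀ B ∈ p.blocks.parts, ∃ g : G, ∀ a ∈ B, q.label a = p.label a * g

instance gSetoid (n : ℕ) (G : Type) [Group G] : Setoid (GPrepartition n G) where
  r := Equivalent
  iseqv := by
    refine ⟨fun p => ⟨rfl, rfl, fun B _ => ⟨1, by simp⟩⟩, ?_, ?_⟩
    · rintro p q ⟨h1, h2, h3⟩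
      refine ⟨h1.symm, h2.symm, fun B hB => ?_⟩
      obtain ⟨g, hg⟩ := h3 B (h2 ▸ hB)
      exact ⟨g⁻¹, fun a ha => by simp [hg a ha]⟩
    · rintro p q s ⟨h1, h2, h3⟩ ⟨k1, k2, k3⟩
      refine ⟨h1.trans k1, h2.trans k2, fun B hB => ?_⟩
      obtain ⟨g, hg⟩ := h3 B hB
      obtain ⟨g', hg'⟩ := k3 B (h2 ▸ hB)
      exact ⟨g * g', fun a ha => by simp [hg a ha, hg' a ha, mul_assoc]⟩

/-- The underlying set of the Dowling lattice `Q_n(G)`: the `G`-partitions, i.e. equivalence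
classes of `G`-prepartitions. -/
def GPartition (n : ℕ) (G : Type) [Group G] : Type := Quotient (gSetoid n G)

/-- The class of a `G`-prepartition. -/
def mk (p : GPrepartition n G) : GPartition n G := Quotient.mk (gSetoid n G) p

/-- `q` is obtained from `p` by merging the nonzero block `B` into the zero block. -/
def ZeroMerge (p q : GPrepartition n G) : Prop :=
  ∃ B ∈ p.blocks.parts,
    q.zero = p.zero ∪ B ∧ q.blocks.parts = p.blocks.parts.erase B ∧
      ∀ a ∉ q.zero, q.label a = p.label a

/-- `q` is obtained from `p` by merging two distinct nonzero blocks `B` and `C` into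
`(B, γ) ∪ (C, γ) · g` for some `g : G`. -/
def BlockMerge (p q : GPrepartition n G) : Prop :=
  ∃ B ∈ p.blocks.parts, ∃ C ∈ p.blocks.parts, B ≠ C ∧ ∃ g : G,
    q.zero = p.zero ∧
      q.blocks.parts = insert (B ∪ C) ((p.blocks.parts.erase B).erase C) ∧
      (∀ a ∈ C, q.label a = p.label a * g) ∧
      ∀ a ∉ q.zero, a ∉ C → q.label a = p.label a

/-- The covering relation of the Dowling lattice: `y` is obtained from `x` by merging two
`G`-blocks. -/
def Covers (x y : GPartition n G) : Prop :=
  ∃ p q : GPrepartition n G, mk p = x ∧ mk q = y ∧ (ZeroMerge p q ∨ BlockMerge p q)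

/-- The number of nonzero blocks. -/
def numBlocks (x : GPartition n G) : ℕ :=
  Quotient.lift (fun p : GPrepartition n G => p.blocks.parts.card)
    (fun _ _ (h : Equivalent _ _) => congrArg Finset.card h.2.1) x

theorem Covers.numBlocks_lt {x y : GPartition n G} (h : Covers x y) : numBlocks y < numBlocks x := by
  obtain ⟨p, q, rfl, rfl, h⟩ := h
  change q.blocks.parts.card < p.blocks.parts.card
  rcases h with ⟨B, hB, -, h, -⟩ | ⟨B, hB, C, hC, hBC, g, -, h, -⟩
  · rw [h]
    exact Finset.card_erase_lt_of_mem hB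
  · have h1 := Finset.card_erase_lt_of_mem hB
    have h2 := Finset.card_erase_lt_of_mem (Finset.mem_erase.2 ⟨hBC.symm, hC⟩)
    have h3 := Finset.card_insert_le (B ∪ C) ((p.blocks.parts.erase B).erase C)
    rw [h]
    omega

/-- The partial order of the Dowling lattice, generated by the covering relation. -/
instance : PartialOrder (GPartition n G) where
  le := Relation.ReflTransGen Covers
  le_refl _ := Relation.ReflTransGen.refl
  le_trans _ _ _ := Relation.ReflTransGen.trans
  le_antisymm x y hxy hyx := by
    have key : ∀ {u v : GPartition n G}, Relation.ReflTransGen Covers u v →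
        numBlocks v ≤ numBlocks u := by
      intro u v h
      induction h with
      | refl => exact le_rfl
      | tail _ h ih => exact h.numBlocks_lt.le.trans ih
    rcases Relation.ReflTransGen.cases_head hxy with h | ⟨z, hxz, hzy⟩
    · exact h
    · have := hxz.numBlocks_lt
      have := key (hzy.trans hyx)
      omega

/-- The prepartition with empty zero block and all nonzero blocks singletons. -/
def preBot (n : ℕ) (G : Type) [Group G] : GPrepartition n G where
  zero := ∅
  blocks := (⊥ : Finpartition (∅ᶜ : Finset (Fin n)))
  label _ := 1

/-- The prepartition with zero block `[n]` and no nonzero blocks. -/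
def preTop (n : ℕ) (G : Type) [Group G] : GPrepartition n G where
  zero := Finset.univ
  blocks := (Finpartition.empty (Finset (Fin n))).copy (by simp)
  label _ := 1

theorem le_of_covers {x y : GPartition n G} (h : Covers x y) : x ≤ y := Relation.ReflTransGen.single h

theorem le_top_aux (k : ℕ) :
    ∀ p : GPrepartition n G, p.blocks.parts.card = k → mk p ≤ mk (preTop n G) := by
  induction k with
  | zero =>
    intro p hp
    have hp' : p.blocks.parts = ∅ := Finset.card_eq_zero.1 hp
    have hz : p.zero = Finset.univ := by
      have := p.blocks.sup_parts
      rw [hp'] at this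
      simpa using this.symm
    refine le_of_eq (Quotient.sound ⟨hz, ?_, ?_⟩)
    · rw [hp']; rfl
    · simp [hp']
  | succ k ih =>
    intro p hp
    obtain ⟨B, hB⟩ : p.blocks.parts.Nonempty := Finset.card_pos.1 (by omega)
    have hsup : (p.blocks.parts.erase B).sup id = (p.zero ∪ B)ᶜ := by
      have h1 := p.blocks.supIndep (Finset.erase_subset B _) hB (Finset.notMem_erase B _)
      have h2 := p.blocks.sup_parts
      rw [← Finset.insert_erase hB, Finset.sup_insert] at h2
      simp only [id] at h1 h2 ⊢
      rw [Finset.compl_union]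
      refine Eq.trans ?_ (congrArg (· ∩ Bᶜ) h2)
      ext a
      have : a ∈ B → a ∉ (p.blocks.parts.erase B).sup id :=
        fun h => Finset.disjoint_left.1 h1 h
      simp only [Finset.sup_eq_union, Finset.mem_union, Finset.mem_inter, Finset.mem_compl]
      tauto
    let q : GPrepartition n G :=
      ⟨p.zero ∪ B, p.blocks.ofSubset (Finset.erase_subset B _) hsup, p.label⟩
    refine le_trans (le_of_covers ⟨p, q, rfl, rfl, Or.inl ⟨B, hB, rfl, rfl, fun _ _ => rfl⟩⟩)
      (ih q ?_)
    change (p.blocks.parts.erase B).card = k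
    rw [Finset.card_erase_of_mem hB]
    omega

theorem bot_le_aux (k : ℕ) :
    ∀ p : GPrepartition n G, n - p.blocks.parts.card = k → mk (preBot n G) ≤ mk p := by
  induction k using Nat.strong_induction_on with
  | _ k ih =>
    intro p hp
    have hcard : ∀ q : GPrepartition n G, q.blocks.parts.card ≤ n := fun q =>
      (q.blocks.card_parts_le_card).trans ((Finset.card_le_univ _).trans (by simp))
    by_cases hz : p.zero = ∅
    · by_cases hs : ∀ B ∈ p.blocks.parts, B.card ≤ 1
      · have hs' : ∀ B ∈ p.blocks.parts, ∃ a, B = {a} := fun B hB =>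
          Finset.card_eq_one.1 (le_antisymm (hs B hB)
            (Finset.card_pos.2 (p.blocks.nonempty_of_mem_parts hB)))
        refine le_of_eq (Quotient.sound ⟨hz.symm, ?_, ?_⟩)
        · ext B
          change B ∈ (⊥ : Finpartition (∅ᶜ : Finset (Fin n))).parts ↔ _
          simp only [Finpartition.mem_bot_iff]
          constructor
          · rintro ⟨a, -, rfl⟩
            obtain ⟨B, hB, ha⟩ := p.blocks.exists_mem (a := a) (by simp [hz])
            obtain ⟨b, rfl⟩ := hs' B hB
            rw [Finset.mem_singleton.1 ha]
            exact hB
          · intro hB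
            obtain ⟨b, rfl⟩ := hs' B hB
            exact ⟨b, by simp, rfl⟩
        · intro B hB
          change B ∈ (⊥ : Finpartition (∅ᶜ : Finset (Fin n))).parts at hB
          obtain ⟨a, -, rfl⟩ := Finpartition.mem_bot_iff.1 hB
          exact ⟨p.label a, fun b hb => by
            rw [Finset.mem_singleton.1 hb]; exact (one_mul _).symm⟩
      · push Not at hs
        obtain ⟨B, hB, hB1⟩ := hs
        obtain ⟨a, ha⟩ := p.blocks.nonempty_of_mem_parts hB
        have hC : (B.erase a).Nonempty := by
          rw [← Finset.card_pos, Finset.card_erase_of_mem ha]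
          omega
        have hins : insert a (B.erase a) = B := Finset.insert_erase ha
        have hdis : ∀ D ∈ p.blocks.parts.erase B, Disjoint D B := fun D hD =>
          p.blocks.disjoint (Finset.mem_of_mem_erase hD) hB (Finset.ne_of_mem_erase hD)
        let P0 := p.blocks.ofSubset (Finset.erase_subset B _) (rfl)
        have hd0 : Disjoint ((p.blocks.parts.erase B).sup id) B :=
          Finset.disjoint_sup_left.2 hdis
        have hd1 : Disjoint ((p.blocks.parts.erase B).sup id) (B.erase a) :=
          hd0.mono_right (Finset.erase_subset a B)
        let P1 := P0.extend (b := B.erase a) hC.ne_empty hd1 rfl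
        have hsup : (p.blocks.parts.erase B).sup id ⊔ B = p.zeroᶜ := by
          have h := p.blocks.sup_parts
          rw [← Finset.insert_erase hB, Finset.sup_insert] at h
          exact (sup_comm _ _).trans h
        let P2 : Finpartition p.zeroᶜ := P1.extend (b := {a}) (by simp)
          (by
            refine Finset.disjoint_singleton_right.2 ?_
            have := Finset.disjoint_right.1 hd0 ha
            simp only [Finset.sup_eq_union, Finset.mem_union, Finset.mem_erase]
            tauto)
          (by
            refine Eq.trans ?_ hsup
            rw [sup_assoc]
            congr 1
            rw [sup_comm]
            exact hins)
        let q : GPrepartition n G := ⟨p.zero, P2, p.label⟩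
        have hqp : q.blocks.parts = insert {a} (insert (B.erase a) (p.blocks.parts.erase B)) := rfl
        have hC' : B.erase a ∉ p.blocks.parts.erase B := fun h => by
          have := hdis _ h
          obtain ⟨c, hc⟩ := hC
          exact Finset.disjoint_left.1 this hc (Finset.mem_of_mem_erase hc)
        have hne : ({a} : Finset (Fin n)) ≠ B.erase a := fun h =>
          Finset.notMem_erase a B (h ▸ Finset.mem_singleton_self a)
        have ha' : {a} ∉ insert (B.erase a) (p.blocks.parts.erase B) := fun h => by
          rcases Finset.mem_insert.1 h with h | h
          · exact hne h
          · exact Finset.disjoint_left.1 (hdis _ h) (Finset.mem_singleton_self a) ha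
        have hqc : q.blocks.parts.card = p.blocks.parts.card + 1 := by
          rw [hqp, Finset.card_insert_of_notMem ha', Finset.card_insert_of_notMem hC',
            Finset.card_erase_of_mem hB]
          have := Finset.card_pos.2 ⟨B, hB⟩
          omega
        have := hcard q
        refine le_trans (ih (n - q.blocks.parts.card) (by omega) q rfl)
          (le_of_covers ⟨q, p, rfl, rfl, Or.inr ⟨{a}, ?_, B.erase a, ?_, hne, 1, rfl, ?_, ?_, ?_⟩⟩)
        · rw [hqp]; simp
        · rw [hqp]; simp
        · rw [hqp, Finset.erase_insert ha', Finset.erase_insert hC', Finset.singleton_union, hins,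
            Finset.insert_erase hB]
        · exact fun b _ => (mul_one _).symm
        · exact fun _ _ _ => rfl
    · obtain ⟨a, ha⟩ := Finset.nonempty_iff_ne_empty.2 hz
      have hda : Disjoint p.zeroᶜ {a} := by simpa using ha
      let q : GPrepartition n G := ⟨p.zero.erase a,
        p.blocks.extend (b := {a}) (by simp) hda
          (by ext b; by_cases hb : b = a <;> simp [hb]), p.label⟩
      have hqp : q.blocks.parts = insert {a} p.blocks.parts := rfl
      have ha' : {a} ∉ p.blocks.parts := fun h =>
        Finset.disjoint_left.1 hda (p.blocks.le h (Finset.mem_singleton_self a))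
          (Finset.mem_singleton_self a)
      have hqc : q.blocks.parts.card = p.blocks.parts.card + 1 := by
        rw [hqp, Finset.card_insert_of_notMem ha']
      have := hcard q
      refine le_trans (ih (n - q.blocks.parts.card) (by omega) q rfl)
        (le_of_covers ⟨q, p, rfl, rfl, Or.inl ⟨{a}, ?_, ?_, ?_, fun _ _ => rfl⟩⟩)
      · rw [hqp]; simp
      · change p.zero = p.zero.erase a ∪ {a}
        rw [Finset.union_comm, Finset.singleton_union, Finset.insert_erase ha]
      · rw [hqp, Finset.erase_insert ha']

/-- The minimum `0̂` is the class of `preBot`, the maximum `1̂` is the class of `preTop`. -/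
instance : BoundedOrder (GPartition n G) where
  bot := mk (preBot n G)
  bot_le x := Quotient.inductionOn x fun p => bot_le_aux _ p rfl
  top := mk (preTop n G)
  le_top x := Quotient.inductionOn x fun p => le_top_aux _ p rfl

instance [Finite G] : Finite (GPartition n G) := by
  have : Finite (GPrepartition n G) :=
    Finite.of_injective
      (fun p => (p.zero, p.blocks.parts, p.label) :
        GPrepartition n G → Finset (Fin n) × Finset (Finset (Fin n)) × (Fin n → G)) (by
      rintro ⟨z, b, l⟩ ⟨z', b', l'⟩ h
      simp only [Prod.mk.injEq] at h
      obtain ⟨rfl, h, rfl⟩ := h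
      obtain rfl := Finpartition.ext h
      rfl)
  exact Quotient.finite _

end Dowling

/-- `Q_n(r)`, the Dowling lattice of the cyclic group `μ_r`, identified with `ℤ/rℤ`
(written multiplicatively). -/
abbrev DowlingQ (n r : ℕ) : Type := Dowling.GPartition n (Multiplicative (ZMod r))

namespace DowlingQ

open Dowling

/-- `Q_n(r, d)`: every nonzero block has size divisible by `d`; together with `0̂`. -/
def divisible (n r d : ℕ) : Set (DowlingQ n r) :=
  {x | ∃ p, mk p = x ∧ ∀ B ∈ p.blocks.parts, d ∣ B.card} ∪ {⊥}

/-- `Q_n(r, d, k)` (for `k ∣ r`): the elements of `Q_n(r, d)` such that for every nonzero block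
`(B, γ)` the number of `a ∈ B` with `γ(a) ≡ j (mod k)` does not depend on `j`;
together with `0̂`. -/
def evenlyColoured (n r d k : ℕ) : Set (DowlingQ n r) :=
  {x ∈ divisible n r d | ∃ p, mk p = x ∧ ∀ B ∈ p.blocks.parts, ∀ j j' : ℕ,
    (B.filter fun a => (p.label a).toAdd.val ≡ j [MOD k]).card =
      (B.filter fun a => (p.label a).toAdd.val ≡ j' [MOD k]).card} ∪ {⊥}

/-- `Q_n(r, d, k, J)`: the elements of `Q_n(r, d, k)` whose zero block has size not in `J`;
together with `0̂`. -/
def restricted (n r d k : ℕ) (J : Set ℕ) : Set (DowlingQ n r) :=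
  {x ∈ evenlyColoured n r d k | ∃ p, mk p = x ∧ p.zero.card ∉ J} ∪ {⊥}

theorem bot_mem_restricted (n r d k : ℕ) (J : Set ℕ) : ⊥ ∈ restricted n r d k J := Or.inr rfl

theorem top_mem_restricted (n r d k : ℕ) : ⊤ ∈ restricted n r d k {0} := by
  rcases Nat.eq_zero_or_pos n with rfl | hn
  · refine Or.inr (Quotient.sound ⟨Subsingleton.elim _ _, ?_, ?_⟩)
    · ext B
      change B ∈ (∅ : Finset _) ↔ B ∈ (⊥ : Finpartition (∅ᶜ : Finset (Fin 0))).parts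
      simp
    · rintro B hB
      exact absurd hB (Finset.notMem_empty B)
  · have h : ∀ B ∈ (preTop n (Multiplicative (ZMod r))).blocks.parts, False :=
      fun B hB => Finset.notMem_empty B hB
    exact Or.inl ⟨Or.inl ⟨Or.inl ⟨preTop n _, rfl, fun B hB => (h B hB).elim⟩,
      preTop n _, rfl, fun B hB => (h B hB).elim⟩, preTop n _, rfl, by simp [preTop]; omega⟩

/-- The order on `Q_n(r, d, k, {0})` is induced from `Q_n(r)`, with the same `0̂` and `1̂`. -/
instance (n r d k : ℕ) : BoundedOrder (restricted n r d k {0}) where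
  bot := ⟨⊥, bot_mem_restricted n r d k {0}⟩
  bot_le x := bot_le (a := (x : DowlingQ n r))
  top := ⟨⊤, top_mem_restricted n r d k⟩
  le_top x := le_top (a := (x : DowlingQ n r))

end DowlingQ

open scoped Classical in
/-- The Möbius function `μ(P) = μ(0̂, 1̂)` of a finite bounded poset `P`. -/
noncomputable def posetMoebius (P : Type) [PartialOrder P] [BoundedOrder P] [Finite P] : ℤ :=
  letI := Fintype.ofFinite P
  letI : LocallyFiniteOrder P := Fintype.toLocallyFiniteOrder
  IncidenceAlgebra.mu ℤ (⊥ : P) (⊤ : P)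

/-- The power `f ^ α` of a formal power series `f` with constant term `1`, for rational `α`:
the binomial series `∑ₖ (α choose k) (f - 1) ^ k`. -/
noncomputable def seriesPow (f : ℚ⟦X⟧) (α : ℚ) : ℚ⟦X⟧ :=
  (PowerSeries.binomialSeries ℚ α).subst (f - 1)

/-! Take a set of `t` free `G`-orbits together with one fixed point `none`. A function `f` from
`[m]` to it has a kernel: the `G`-partition whose zero block is the preimage of `none`, whose blocks
are the nonempty preimages of the orbits, and whose labels are the `G`-coordinates. By
`mk_le_mk_kernel`, `y` lies below the kernel of `f` exactly when `f` vanishes on the zero block of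
`y` and is equivariant on each other block, so `f` amounts to one arbitrary value per block. With
`b(y)` nonzero blocks this gives `(1 + |G| t) ^ b(y)` functions. Exactly `w_z(t) = |G| ^ b(z) * t (t
- 1) ⋯ (t - b(z) + 1)` functions have kernel `z`. Hence the sum of `w_z` over `z ≥ y` equals `(1 +
|G| t) ^ b(y)`, an identity of polynomials in `t`. At `t = -1/|G|` the right side is `1` for `y = ⊤`
and `0` otherwise (`sum_eval_weight_ge`). This is the recursion that determines `μ(y, ⊤)`, so `μ(z,
⊤) = w_z(-1/|G|)`.

The elements of the subposet other than its minimum form an upper set of the Dowling lattice, so the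
same values serve there, and `μ(⊥, ⊤)` is minus their sum (`posetMoebius_eq_neg_sum`). For natural
`t`, the sum of `w_z(t)` over these `z` counts the functions that take the value `none` and whose
fibres over each orbit are equidistributed mod `d`. A multinomial count (`card_kernel_mem_balanced`)
gives `(dn)!` times the coefficient of `x ^ n` in `E F ^ t`, with `E` for the zero block and `F` for
one orbit. Both sides are polynomial in `t` (`exists_polynomial_coeff_mul_seriesPow`), so `t =
-1/(dr)` may be substituted. Rescaling `x` by `d / r ^ (d - 1)` gives the stated normalisation. -/

namespace Dowling

/-! ### `G`-partitions as kernels of functions to a free `G`-set with a fixed point -/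

variable {n : ℕ} {G T : Type}

/-- The action of `G` on a free `G`-set with orbit set `T`, together with a fixed point `none`. -/
def act [Mul G] (g : G) (x : Option (G × T)) : Option (G × T) :=
  x.map fun y => (g * y.1, y.2)

@[simp] theorem act_none [Mul G] (g : G) : act g (none : Option (G × T)) = none := rfl

@[simp] theorem act_some [Mul G] (g : G) (y : G × T) : act g (some y) = some (g * y.1, y.2) := rfl

@[simp] theorem act_eq_none [Mul G] {g : G} {x : Option (G × T)} : act g x = none ↔ x = none := by
  cases x <;> simp

theorem act_act [Semigroup G] (g h : G) (x : Option (G × T)) : act g (act h x) = act (g * h) x := by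
  cases x <;> simp [mul_assoc]

theorem act_injective [Group G] (g : G) : Function.Injective (act g : Option (G × T) → _) := by
  rintro (_ | ⟨x, s⟩) (_ | ⟨y, t⟩) h <;> simp_all

theorem GPrepartition.exists_block (p : GPrepartition n G) {a : Fin n} (ha : a ∉ p.zero) :
    ∃ B ∈ p.blocks.parts, a ∈ B :=
  p.blocks.exists_mem (by simpa using ha)

theorem GPrepartition.notMem_zero (p : GPrepartition n G) {a : Fin n} {B : Finset (Fin n)}
    (hB : B ∈ p.blocks.parts) (ha : a ∈ B) : a ∉ p.zero := by
  simpa using p.blocks.le hB ha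

variable [Group G]

/-- The function `f` vanishes on the zero block and is equivariant on every nonzero block. -/
def Compat (p : GPrepartition n G) (f : Fin n → Option (G × T)) : Prop :=
  (∀ a ∈ p.zero, f a = none) ∧
    ∀ B ∈ p.blocks.parts, ∃ x, ∀ a ∈ B, f a = act (p.label a) x

/-- The function `f` is compatible with `p`, vanishes only on the zero block, and separates the
nonzero blocks. -/
def Exact (p : GPrepartition n G) (f : Fin n → Option (G × T)) : Prop :=
  Compat p f ∧ (∀ a, f a = none → a ∈ p.zero) ∧
    ∀ a b g h s, f a = some (g, s) → f b = some (h, s) → ∃ B ∈ p.blocks.parts, a ∈ B ∧ b ∈ B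

theorem Compat.of_equivalent {p q : GPrepartition n G} {f : Fin n → Option (G × T)}
    (h : Equivalent p q) (hp : Compat p f) : Compat q f := by
  obtain ⟨h1, h2, h3⟩ := h
  refine ⟨h1 ▸ hp.1, fun B hB => ?_⟩
  obtain ⟨x, hx⟩ := hp.2 B (h2 ▸ hB)
  obtain ⟨g, hg⟩ := h3 B (h2 ▸ hB)
  exact ⟨act g⁻¹ x, fun a ha => by simp [hx a ha, act_act, hg a ha]⟩

theorem Exact.of_equivalent {p q : GPrepartition n G} {f : Fin n → Option (G × T)}
    (h : Equivalent p q) (hp : Exact p f) : Exact q f := by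
  refine ⟨hp.1.of_equivalent h, ?_, ?_⟩
  · rw [← h.1]; exact hp.2.1
  · rw [← h.2.1]; exact hp.2.2

/-- The blocks can be read off from an exact `f`: lying in one block means taking values in one
orbit. -/
theorem Exact.mem_block_iff {p : GPrepartition n G} {f : Fin n → Option (G × T)}
    (h : Exact p f) {B : Finset (Fin n)} (hB : B ∈ p.blocks.parts) {a : Fin n} (ha : a ∈ B)
    (b : Fin n) : b ∈ B ↔ ∃ g h s, f a = some (g, s) ∧ f b = some (h, s) := by
  obtain ⟨x, hx⟩ := h.1.2 B hB
  constructor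
  · intro hb
    rcases x with _ | ⟨g, s⟩
    · exact absurd (h.2.1 a (by simp [hx a ha])) (p.notMem_zero hB ha)
    · exact ⟨_, _, s, hx a ha, hx b hb⟩
  · rintro ⟨g, k, s, h1, h2⟩
    obtain ⟨C, hC, haC, hbC⟩ := h.2.2 a b g k s h1 h2
    rwa [p.blocks.eq_of_mem_parts hB hC ha haC]

theorem Exact.parts_subset {p q : GPrepartition n G} {f : Fin n → Option (G × T)}
    (hp : Exact p f) (hq : Exact q f) (hz : p.zero = q.zero) :
    p.blocks.parts ⊆ q.blocks.parts := by
  intro B hB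
  obtain ⟨a, ha⟩ := p.blocks.nonempty_of_mem_parts hB
  obtain ⟨C, hC, haC⟩ := q.exists_block (hz ▸ p.notMem_zero hB ha)
  have : B = C := by
    ext b
    rw [hp.mem_block_iff hB ha, hq.mem_block_iff hC haC]
  rwa [this]

theorem Exact.equivalent {p q : GPrepartition n G} {f : Fin n → Option (G × T)}
    (hp : Exact p f) (hq : Exact q f) : Equivalent p q := by
  have hz : p.zero = q.zero := by
    ext a
    exact ⟨fun h => hq.2.1 a (hp.1.1 a h), fun h => hp.2.1 a (hq.1.1 a h)⟩
  have hparts := (hp.parts_subset hq hz).antisymm (hq.parts_subset hp hz.symm)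
  refine ⟨hz, hparts, fun B hB => ?_⟩
  obtain ⟨x, hx⟩ := hp.1.2 B hB
  obtain ⟨y, hy⟩ := hq.1.2 B (hparts ▸ hB)
  obtain ⟨a, ha⟩ := p.blocks.nonempty_of_mem_parts hB
  rcases x with _ | ⟨g, s⟩
  · exact absurd (hp.2.1 a (by simp [hx a ha])) (p.notMem_zero hB ha)
  rcases y with _ | ⟨h, t⟩
  · have := hx a ha
    rw [hy a ha] at this
    simp at this
  -- On `B` both `p.label b * g` and `q.label b * h` are the `G`-coordinate of `f b`.
  refine ⟨g * h⁻¹, fun b hb => ?_⟩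
  have := hx b hb
  rw [hy b hb] at this
  simp only [act_some, Option.some.injEq, Prod.mk.injEq] at this
  rw [← mul_assoc, ← this.1, mul_inv_cancel_right]

open scoped Classical in
/-- The prepartition into the zero set and the preimages of the `G`-orbits. -/
noncomputable def kernel (f : Fin n → Option (G × T)) : GPrepartition n G where
  zero := Finset.univ.filter fun a => f a = none
  blocks := (Finpartition.ofSetSetoid (Setoid.ker fun a => (f a).map Prod.snd)
    (Finset.univ.filter fun a => f a = none)ᶜ)
  label a := ((f a).map Prod.fst).getD 1

theorem mem_kernel_zero {f : Fin n → Option (G × T)} {a : Fin n} :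
    a ∈ (kernel f).zero ↔ f a = none := by
  simp [kernel]

theorem exact_kernel (f : Fin n → Option (G × T)) : Exact (kernel f) f := by
  classical
  have key : ∀ a b, f a ≠ none → f b ≠ none → ((∃ B ∈ (kernel f).blocks.parts, a ∈ B ∧ b ∈ B) ↔
      (f a).map Prod.snd = (f b).map Prod.snd) := by
    intro a b ha hb
    rw [← Finpartition.mem_part_iff_exists]
    unfold kernel
    simp only
    rw [Finpartition.mem_part_ofSetSetoid_iff_rel]
    simp [ha, hb, Setoid.ker_def, eq_comm]
  refine ⟨⟨fun a => mem_kernel_zero.1, fun B hB => ?_⟩, fun a => mem_kernel_zero.2, ?_⟩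
  · obtain ⟨a, ha⟩ := (kernel f).blocks.nonempty_of_mem_parts hB
    have ha0 : f a ≠ none := fun h => (kernel f).notMem_zero hB ha (mem_kernel_zero.2 h)
    obtain ⟨⟨g, s⟩, hg⟩ := Option.ne_none_iff_exists'.1 ha0
    -- The labels of the kernel are the `G`-coordinates themselves, so the base value has coordinate
    -- `1`.
    refine ⟨some (1, s), fun b hb => ?_⟩
    have hb0 : f b ≠ none := fun h => (kernel f).notMem_zero hB hb (mem_kernel_zero.2 h)
    obtain ⟨⟨h, t⟩, hh⟩ := Option.ne_none_iff_exists'.1 hb0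
    have := (key a b ha0 hb0).1 ⟨B, hB, ha, hb⟩
    simp only [hg, hh, Option.map_some, Option.some.injEq] at this
    simp [kernel, hh, this]
  · intro a b g h s h1 h2
    exact (key a b (by simp [h1]) (by simp [h2])).2 (by simp [h1, h2])

theorem mk_eq_mk_kernel {p : GPrepartition n G} {f : Fin n → Option (G × T)} :
    mk p = mk (kernel f) ↔ Exact p f :=
  ⟨fun h => (exact_kernel f).of_equivalent (Quotient.exact h.symm),
    fun h => Quotient.sound (h.equivalent (exact_kernel f))⟩

theorem Compat.of_zeroMerge {p q : GPrepartition n G} {f : Fin n → Option (G × T)}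
    (h : ZeroMerge p q) (hq : Compat q f) : Compat p f := by
  obtain ⟨B, hB, h1, h2, h3⟩ := h
  refine ⟨fun a ha => hq.1 a (by simp [h1, ha]), fun D hD => ?_⟩
  rcases eq_or_ne D B with rfl | hDB
  · exact ⟨none, fun a ha => by rw [hq.1 a (by simp [h1, ha]), act_none]⟩
  · have hD' : D ∈ q.blocks.parts := by rw [h2]; exact Finset.mem_erase.2 ⟨hDB, hD⟩
    obtain ⟨x, hx⟩ := hq.2 D hD'
    exact ⟨x, fun a ha => by rw [hx a ha, h3 a (q.notMem_zero hD' ha)]⟩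

theorem Compat.of_blockMerge {p q : GPrepartition n G} {f : Fin n → Option (G × T)}
    (h : BlockMerge p q) (hq : Compat q f) : Compat p f := by
  obtain ⟨B, hB, C, hC, hBC, g, h1, h2, h3, h4⟩ := h
  refine ⟨fun a ha => hq.1 a (by simp [h1, ha]), fun D hD => ?_⟩
  have hBC' : B ∪ C ∈ q.blocks.parts := by simp [h2]
  rcases eq_or_ne D C with rfl | hDC
  · obtain ⟨x, hx⟩ := hq.2 _ hBC'
    exact ⟨act g x, fun a ha => by
      rw [hx a (Finset.mem_union_right _ ha), h3 a ha, act_act]⟩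
  have hdis : ∀ a ∈ D, a ∉ C := fun a ha haC => hDC (p.blocks.eq_of_mem_parts hD hC ha haC)
  rcases eq_or_ne D B with rfl | hDB
  · obtain ⟨x, hx⟩ := hq.2 _ hBC'
    exact ⟨x, fun a ha => by
      rw [hx a (Finset.mem_union_left _ ha),
        h4 a (q.notMem_zero hBC' (Finset.mem_union_left _ ha)) (hdis a ha)]⟩
  · have hD' : D ∈ q.blocks.parts := by simp [h2, hDC, hDB, hD]
    obtain ⟨x, hx⟩ := hq.2 D hD'
    exact ⟨x, fun a ha => by rw [hx a ha, h4 a (q.notMem_zero hD' ha) (hdis a ha)]⟩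

/-- Compatibility descends along each cover: a block merged into zero receives the base value
`none`, and a block twisted by `g` has its base value moved by `g`. -/
theorem Compat.of_le {f : Fin n → Option (G × T)} {x y : GPartition n G} (h : x ≤ y) :
    (∀ q, mk q = y → Compat q f) → ∀ p, mk p = x → Compat p f := by
  induction h using Relation.ReflTransGen.head_induction_on with
  | refl => exact id
  | head h _ ih =>
    intro hy p hp
    obtain ⟨p', q', h1, h2, h3⟩ := h
    have hq' := ih hy q' h2
    have hp' : Compat p' f := h3.elim (fun h => hq'.of_zeroMerge h) fun h => hq'.of_blockMerge h
    exact hp'.of_equivalent (Quotient.exact (h1.trans hp.symm))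

/-- Merging a nonzero block into the zero block. -/
def GPrepartition.zeroMerge (p : GPrepartition n G) {B : Finset (Fin n)}
    (hB : B ∈ p.blocks.parts) : GPrepartition n G where
  zero := p.zero ∪ B
  blocks := p.blocks.ofSubset (Finset.erase_subset B _) (by
    have h1 := p.blocks.supIndep (Finset.erase_subset B _) hB (Finset.notMem_erase B _)
    have h2 := p.blocks.sup_parts
    rw [← Finset.insert_erase hB, Finset.sup_insert] at h2
    simp only [id] at h1 h2 ⊢
    rw [Finset.compl_union]
    refine Eq.trans ?_ (congrArg (· ∩ Bᶜ) h2)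
    ext a
    have : a ∈ B → a ∉ (p.blocks.parts.erase B).sup id :=
      fun h => Finset.disjoint_left.1 h1 h
    simp only [Finset.sup_eq_union, Finset.mem_union, Finset.mem_inter, Finset.mem_compl]
    tauto)
  label := p.label

/-- Merging two nonzero blocks, with the labels of the second one multiplied by `g`. -/
def GPrepartition.blockMerge (p : GPrepartition n G) {B C : Finset (Fin n)}
    (hB : B ∈ p.blocks.parts) (hC : C ∈ p.blocks.parts) (hBC : B ≠ C) (g : G) :
    GPrepartition n G where
  zero := p.zero
  blocks := (p.blocks.ofSubset
      ((Finset.erase_subset C _).trans (Finset.erase_subset B _)) rfl).extend (b := B ∪ C)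
    (by
      obtain ⟨b, hb⟩ := p.blocks.nonempty_of_mem_parts hB
      exact Finset.nonempty_iff_ne_empty.1 ⟨b, Finset.mem_union_left _ hb⟩)
    (by
      refine Finset.disjoint_sup_left.2 fun D hD => Finset.disjoint_union_right.2 ⟨?_, ?_⟩
      · simp only [Finset.mem_erase] at hD
        exact p.blocks.disjoint hD.2.2 hB hD.2.1
      · simp only [Finset.mem_erase] at hD
        exact p.blocks.disjoint hD.2.2 hC hD.1)
    (by
      have h := p.blocks.sup_parts
      rw [← Finset.insert_erase hB, Finset.sup_insert,
        ← Finset.insert_erase (Finset.mem_erase.2 ⟨hBC.symm, hC⟩), Finset.sup_insert] at h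
      refine Eq.trans ?_ h
      ext a
      simp only [Finset.sup_eq_union, Finset.mem_union, id]
      tauto)
  label a := if a ∈ C then p.label a * g else p.label a

/-- Induction on the number of blocks. If `f` vanishes on a block, that block is merged into the
zero block. If two blocks take values in one orbit, they are merged with the appropriate twist. Both
moves preserve compatibility, and when neither applies `f` is exact. -/
theorem Compat.mk_le_aux (f : Fin n → Option (G × T)) (k : ℕ) :
    ∀ p : GPrepartition n G, p.blocks.parts.card = k → Compat p f → mk p ≤ mk (kernel f) := by
  induction k using Nat.strong_induction_on with
  | _ k ih =>
    intro p hk hp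
    by_cases h1 : ∃ B, B ∈ p.blocks.parts ∧ ∀ a ∈ B, f a = none
    · obtain ⟨B, hB, h⟩ := h1
      have hc : Covers (mk p) (mk (p.zeroMerge hB)) :=
        ⟨p, p.zeroMerge hB, rfl, rfl, Or.inl ⟨B, hB, rfl, rfl, fun _ _ => rfl⟩⟩
      refine (le_of_covers hc).trans (ih _ (hk ▸ hc.numBlocks_lt) _ rfl ⟨fun a ha => ?_, ?_⟩)
      · rcases Finset.mem_union.1 ha with ha | ha
        exacts [hp.1 a ha, h a ha]
      · exact fun D hD => hp.2 D (Finset.mem_of_mem_erase hD)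
    by_cases h2 : ∃ B C g h s, B ∈ p.blocks.parts ∧ C ∈ p.blocks.parts ∧ B ≠ C ∧
        (∀ a ∈ B, f a = act (p.label a) (some (g, s))) ∧
        ∀ a ∈ C, f a = act (p.label a) (some (h, s))
    · obtain ⟨B, C, g, h, s, hB, hC, hBC, hg, hh⟩ := h2
      have hdis : ∀ D ∈ p.blocks.parts, D ≠ C → ∀ a ∈ D, a ∉ C := fun D hD hDC a ha haC =>
        hDC (p.blocks.eq_of_mem_parts hD hC ha haC)
      -- The twist turns the base value `(h, s)` of `C` into the base value `(g, s)` of `B`.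
      let q := p.blockMerge hB hC hBC (h * g⁻¹)
      have hlab : ∀ a, q.label a = if a ∈ C then p.label a * (h * g⁻¹) else p.label a :=
        fun _ => rfl
      have hparts : q.blocks.parts = insert (B ∪ C) ((p.blocks.parts.erase B).erase C) := rfl
      have hc : Covers (mk p) (mk q) := by
        refine ⟨p, q, rfl, rfl, Or.inr ⟨B, hB, C, hC, hBC, h * g⁻¹, rfl, rfl, ?_, ?_⟩⟩
        · exact fun a ha => by rw [hlab, if_pos ha]
        · exact fun a _ ha => by rw [hlab, if_neg ha]
      refine (le_of_covers hc).trans (ih _ (hk ▸ hc.numBlocks_lt) _ rfl ⟨hp.1, fun D hD => ?_⟩)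
      rw [hparts, Finset.mem_insert] at hD
      rcases hD with rfl | hD
      · refine ⟨some (g, s), fun a ha => ?_⟩
        rcases Finset.mem_union.1 ha with ha | ha
        · rw [hg a ha, hlab, if_neg (hdis B hB hBC a ha)]
        · rw [hh a ha, hlab, if_pos ha]
          simp [mul_assoc]
      · simp only [Finset.mem_erase] at hD
        obtain ⟨x, hx⟩ := hp.2 D hD.2.2
        exact ⟨x, fun a ha => by rw [hx a ha, hlab, if_neg (hdis D hD.2.2 hD.1 a ha)]⟩
    · push Not at h1 h2
      refine le_of_eq (mk_eq_mk_kernel.2 ⟨hp, fun a ha => ?_, fun a b g h s hg hh => ?_⟩)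
      · by_contra hz
        obtain ⟨B, hB, haB⟩ := p.exists_block hz
        obtain ⟨b, hb, hb'⟩ := h1 B hB
        obtain ⟨x, hx⟩ := hp.2 B hB
        have := hx a haB
        rw [ha, eq_comm, act_eq_none] at this
        exact hb' (by rw [hx b hb, this, act_none])
      · have hza : a ∉ p.zero := fun h => by simp [hp.1 a h] at hg
        have hzb : b ∉ p.zero := fun h => by simp [hp.1 b h] at hh
        obtain ⟨B, hB, haB⟩ := p.exists_block hza
        obtain ⟨C, hC, hbC⟩ := p.exists_block hzb
        obtain ⟨x, hx⟩ := hp.2 B hB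
        obtain ⟨y, hy⟩ := hp.2 C hC
        have hxa := hx a haB
        have hyb := hy b hbC
        rw [hg] at hxa
        rw [hh] at hyb
        rcases x with _ | ⟨x, s'⟩
        · simp at hxa
        rcases y with _ | ⟨y, t'⟩
        · simp at hyb
        simp only [act_some, Option.some.injEq, Prod.mk.injEq] at hxa hyb
        obtain ⟨-, rfl⟩ := hxa
        obtain ⟨-, rfl⟩ := hyb
        by_cases hBC : B = C
        · exact ⟨B, hB, haB, hBC ▸ hbC⟩
        · obtain ⟨c, hc, hc'⟩ := h2 B C x y s hB hC hBC hx
          exact absurd (hy c hc) hc'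

theorem mk_le_mk_kernel {p : GPrepartition n G} {f : Fin n → Option (G × T)} :
    mk p ≤ mk (kernel f) ↔ Compat p f :=
  ⟨fun h => Compat.of_le h (fun _ hq => (mk_eq_mk_kernel.1 hq).1) p rfl,
    fun h => Compat.mk_le_aux f _ p rfl h⟩

end Dowling

/-! ### Counting functions by their kernel -/

namespace Dowling

section Counting

variable {n : ℕ} {G T : Type} [Group G]

open scoped Classical in
/-- The function with prescribed values, up to the labels, on the nonzero blocks. -/
noncomputable def spread (p : GPrepartition n G) (x : p.blocks.parts → Option (G × T)) :
    Fin n → Option (G × T) := fun a =>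
  if h : a ∈ p.zero then none
  else act (p.label a) (x ⟨p.blocks.part a, p.blocks.part_mem.2 (by simpa using h)⟩)

theorem spread_of_mem_zero (p : GPrepartition n G) (x : p.blocks.parts → Option (G × T))
    {a : Fin n} (ha : a ∈ p.zero) : spread p x a = none := by
  simp [spread, ha]

theorem spread_of_mem (p : GPrepartition n G) (x : p.blocks.parts → Option (G × T))
    (B : p.blocks.parts) {a : Fin n} (ha : a ∈ B.1) : spread p x a = act (p.label a) (x B) := by
  have h : a ∉ p.zero := p.notMem_zero B.2 ha
  have hB : p.blocks.part a = B.1 := p.blocks.part_eq_of_mem B.2 ha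
  simp only [spread, h, dite_false]
  congr 2
  exact Subtype.ext hB

theorem spread_injective (p : GPrepartition n G) :
    Function.Injective (spread p : (p.blocks.parts → Option (G × T)) → _) := by
  intro x y h
  funext B
  obtain ⟨a, ha⟩ := p.blocks.nonempty_of_mem_parts B.2
  have := congrFun h a
  rw [spread_of_mem p x B ha, spread_of_mem p y B ha] at this
  exact act_injective _ this

theorem compat_iff_exists_spread {p : GPrepartition n G} {f : Fin n → Option (G × T)} :
    Compat p f ↔ ∃ x, spread p x = f := by
  constructor
  · intro h
    choose x hx using h.2
    refine ⟨fun B => x B.1 B.2, funext fun a => ?_⟩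
    by_cases ha : a ∈ p.zero
    · rw [spread_of_mem_zero p _ ha, h.1 a ha]
    · obtain ⟨B, hB, haB⟩ := p.exists_block ha
      rw [spread_of_mem p _ ⟨B, hB⟩ haB, hx B hB a haB]
  · rintro ⟨x, rfl⟩
    exact ⟨fun a ha => spread_of_mem_zero p x ha,
      fun B hB => ⟨x ⟨B, hB⟩, fun a ha => spread_of_mem p x ⟨B, hB⟩ ha⟩⟩

/-- Among compatible functions, exactness forbids the base value `none` and forces distinct blocks
into distinct orbits. What remains is a free choice in `G` for each block and an injection of the
blocks into `T`. -/
theorem exact_iff_exists_spread {p : GPrepartition n G} {f : Fin n → Option (G × T)} :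
    Exact p f ↔ ∃ y : (p.blocks.parts → G) × (p.blocks.parts ↪ T),
      spread p (fun B => some (y.1 B, y.2 B)) = f := by
  constructor
  · intro h
    obtain ⟨x, rfl⟩ := compat_iff_exists_spread.1 h.1
    have hx : ∀ B, ∃ y, x B = some y := by
      intro B
      obtain ⟨a, ha⟩ := p.blocks.nonempty_of_mem_parts B.2
      refine Option.ne_none_iff_exists'.1 fun hB => p.notMem_zero B.2 ha (h.2.1 a ?_)
      rw [spread_of_mem p x B ha, hB, act_none]
    choose y hy using hx
    refine ⟨⟨fun B => (y B).1, fun B => (y B).2, fun B C hBC => ?_⟩, ?_⟩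
    · obtain ⟨a, ha⟩ := p.blocks.nonempty_of_mem_parts B.2
      obtain ⟨b, hb⟩ := p.blocks.nonempty_of_mem_parts C.2
      obtain ⟨D, hD, haD, hbD⟩ := h.2.2 a b (p.label a * (y B).1) (p.label b * (y C).1) (y B).2
        (by rw [spread_of_mem p x B ha, hy, act_some])
        (by rw [spread_of_mem p x C hb, hy, act_some]; simp only at hBC; rw [hBC])
      exact Subtype.ext ((p.blocks.eq_of_mem_parts B.2 hD ha haD).trans
        (p.blocks.eq_of_mem_parts C.2 hD hb hbD).symm)
    · congr 1
      funext B
      exact (hy B).symm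
  · rintro ⟨y, rfl⟩
    refine ⟨compat_iff_exists_spread.2 ⟨_, rfl⟩, fun a ha => ?_, fun a b g h s hg hh => ?_⟩
    · by_contra hz
      obtain ⟨B, hB, haB⟩ := p.exists_block hz
      simp [spread_of_mem p _ ⟨B, hB⟩ haB] at ha
    · obtain ⟨B, hB, haB⟩ := p.exists_block (a := a) fun hz => by
        simp [spread_of_mem_zero p _ hz] at hg
      obtain ⟨C, hC, hbC⟩ := p.exists_block (a := b) fun hz => by
        simp [spread_of_mem_zero p _ hz] at hh
      rw [spread_of_mem p _ ⟨B, hB⟩ haB] at hg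
      rw [spread_of_mem p _ ⟨C, hC⟩ hbC] at hh
      simp only [act_some, Option.some.injEq, Prod.mk.injEq] at hg hh
      have hBC := y.2.injective (hg.2.trans hh.2.symm)
      rw [Subtype.mk.injEq] at hBC
      exact ⟨B, hB, haB, hBC ▸ hbC⟩

variable [Fintype G] [Fintype T]

open scoped Classical in
theorem card_le_kernel (y : GPartition n G) :
    (Finset.univ.filter fun f : Fin n → Option (G × T) => y ≤ mk (kernel f)).card =
      (1 + Fintype.card G * Fintype.card T) ^ numBlocks y := by
  induction y using Quotient.inductionOn with
  | _ p =>
    have h : (Finset.univ.filter fun f : Fin n → Option (G × T) => mk p ≤ mk (kernel f)) =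
        Finset.univ.image (spread p) := by
      ext f
      simp [mk_le_mk_kernel, compat_iff_exists_spread]
    change (Finset.univ.filter fun f : Fin n → Option (G × T) => mk p ≤ mk (kernel f)).card =
      (1 + Fintype.card G * Fintype.card T) ^ p.blocks.parts.card
    rw [h, Finset.card_image_of_injective _ (spread_injective p)]
    simp [add_comm]

open scoped Classical in
theorem card_kernel_eq (z : GPartition n G) :
    (Finset.univ.filter fun f : Fin n → Option (G × T) => mk (kernel f) = z).card =
      Fintype.card G ^ numBlocks z * (Fintype.card T).descFactorial (numBlocks z) := by
  induction z using Quotient.inductionOn with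
  | _ p =>
    have h : (Finset.univ.filter fun f : Fin n → Option (G × T) => mk (kernel f) = mk p) =
        Finset.univ.image fun y : (p.blocks.parts → G) × (p.blocks.parts ↪ T) =>
          spread p fun B => some (y.1 B, y.2 B) := by
      ext f
      simp only [eq_comm (b := mk p), mk_eq_mk_kernel, exact_iff_exists_spread, Finset.mem_filter,
        Finset.mem_univ, true_and, Finset.mem_image]
    change (Finset.univ.filter fun f : Fin n → Option (G × T) => mk (kernel f) = mk p).card =
      Fintype.card G ^ p.blocks.parts.card * (Fintype.card T).descFactorial p.blocks.parts.card
    rw [h, Finset.card_image_of_injective]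
    · simp [Fintype.card_embedding_eq]
    · intro y y' hy
      have := spread_injective p hy
      refine Prod.ext (funext fun B => ?_) (DFunLike.ext _ _ fun B => ?_)
      · simpa using congrArg (Option.map Prod.fst) (congrFun this B)
      · simpa using congrArg (Option.map Prod.snd) (congrFun this B)

open scoped Classical in
theorem sum_card_kernel_eq (S : Finset (GPartition n G)) :
    ∑ z ∈ S, Fintype.card G ^ numBlocks z * (Fintype.card T).descFactorial (numBlocks z) =
      (Finset.univ.filter fun f : Fin n → Option (G × T) => mk (kernel f) ∈ S).card := by
  rw [Finset.card_eq_sum_card_fiberwise (f := fun f => mk (kernel f)) (t := S)]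
  · refine Finset.sum_congr rfl fun z hz => ?_
    rw [← card_kernel_eq, Finset.filter_filter]
    congr 1
    ext f
    simp only [Finset.mem_filter, Finset.mem_univ, true_and]
    exact ⟨fun h => ⟨h ▸ hz, h⟩, fun h => h.2⟩
  · intro f hf
    simpa using hf

end Counting

/-! ### Polynomial weights and their value at `-1/|G|` -/

section Weight

open Polynomial

variable {n : ℕ} {G : Type} [Group G]

theorem numBlocks_eq_zero_iff {y : GPartition n G} : numBlocks y = 0 ↔ y = ⊤ := by
  constructor
  · intro h
    rcases Relation.ReflTransGen.cases_head (le_top : y ≤ ⊤) with h' | ⟨z, hz, -⟩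
    · exact h'
    · have := hz.numBlocks_lt
      omega
  · rintro rfl
    rfl

variable [Fintype G]

/-- The number of functions with a given kernel, as a polynomial in the number of orbits. -/
noncomputable def weight (z : GPartition n G) : ℚ[X] :=
  C ((Fintype.card G : ℚ) ^ numBlocks z) * descPochhammer ℚ (numBlocks z)

theorem eval_natCast_weight (z : GPartition n G) (t : ℕ) : (weight z).eval (t : ℚ) =
    (Fintype.card G ^ numBlocks z * t.descFactorial (numBlocks z) : ℕ) := by
  simp [weight, descPochhammer_eval_eq_descFactorial]

theorem eq_of_eval_natCast_eq {p q : ℚ[X]} (h : ∀ t : ℕ, p.eval (t : ℚ) = q.eval (t : ℚ)) :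
    p = q :=
  Polynomial.eq_of_infinite_eval_eq p q
    ((Set.infinite_range_of_injective Nat.cast_injective).mono (by rintro _ ⟨t, rfl⟩; exact h t))

-- For natural `t` both sides count the functions whose kernel is at least `y`, sorted by kernel on
-- the left; agreement at all naturals makes it a polynomial identity.
open scoped Classical in
theorem sum_weight_ge [Fintype (GPartition n G)] (y : GPartition n G) :
    ∑ z ∈ Finset.univ.filter (y ≤ ·), weight z =
      (1 + C (Fintype.card G : ℚ) * X) ^ numBlocks y := by
  refine eq_of_eval_natCast_eq fun t => ?_
  have := sum_card_kernel_eq (T := Fin t) (Finset.univ.filter (y ≤ ·))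
  simp only [Finset.mem_filter, Finset.mem_univ, true_and, card_le_kernel, Fintype.card_fin] at this
  rw [Polynomial.eval_finsetSum]
  simp only [eval_natCast_weight]
  rw [← Nat.cast_sum, this]
  simp

-- The argument is the root of `1 + |G| X`, so the total is `0 ^ numBlocks y`, which is nonzero only
-- when no block is left, that is at `⊤`.
open scoped Classical in
theorem sum_eval_weight_ge [Fintype (GPartition n G)] (y : GPartition n G) :
    ∑ z ∈ Finset.univ.filter (y ≤ ·), (weight z).eval (-1 / (Fintype.card G : ℚ)) =
      if y = ⊤ then 1 else 0 := by
  have hG : (Fintype.card G : ℚ) ≠ 0 := by simp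
  rw [← Polynomial.eval_finsetSum, sum_weight_ge]
  have : (1 : ℚ) + Fintype.card G * (-1 / Fintype.card G) = 0 := by
    field_simp
    ring
  simp only [eval_pow, eval_add, eval_one, eval_mul, eval_C, eval_X, this, zero_pow_eq,
    numBlocks_eq_zero_iff]

end Weight

end Dowling

/-! ### The Möbius function from sums over upper sets -/

section Moebius

-- The hypothesis on `w` is the recursion of `μ(y, ⊤)` in its left argument, so downward induction
-- from `⊤` identifies the two for `y ≠ ⊥`. The recursion at `⊥` itself then expresses `μ(⊥, ⊤)`; no
-- condition on `w ⊥` is needed.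
open scoped Classical in
theorem posetMoebius_eq_neg_sum (P : Type) [PartialOrder P] [BoundedOrder P] [Finite P] [Fintype P]
    (hP : (⊥ : P) ≠ ⊤) (w : P → ℚ)
    (hw : ∀ y ≠ ⊥, ∑ z ∈ Finset.univ.filter (y ≤ ·), w z = if y = ⊤ then 1 else 0) :
    (posetMoebius P : ℚ) = -∑ z ∈ Finset.univ.filter (· ≠ (⊥ : P)), w z := by
  unfold posetMoebius
  let _ : LocallyFiniteOrder P :=
    @Fintype.toLocallyFiniteOrder P _ (Fintype.ofFinite P) _ _
  change (IncidenceAlgebra.mu ℤ (⊥ : P) ⊤ : ℚ) = _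
  have hIcc : ∀ y : P, Finset.Icc y ⊤ = Finset.univ.filter (y ≤ ·) := fun y => by ext; simp
  have hIoc : ∀ y : P, Finset.Ioc y ⊤ = Finset.univ.filter (y < ·) := fun y => by ext; simp
  have key : ∀ y : P, y ≠ ⊥ → (IncidenceAlgebra.mu ℤ y ⊤ : ℚ) = w y := by
    intro y
    induction y using (wellFounded_gt (α := P)).induction with
    | _ y ih =>
      intro hy
      have h1 := IncidenceAlgebra.sum_Icc_mu_left (𝕜 := ℤ) y (⊤ : P)
      have h2 := hw y hy
      have hins : Finset.univ.filter (y ≤ ·) = insert y (Finset.univ.filter (y < ·)) := by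
        ext z
        simp [le_iff_eq_or_lt, eq_comm]
      have hy' : y ∉ Finset.univ.filter (y < ·) := by simp
      rw [hIcc, hins, Finset.sum_insert hy'] at h1
      rw [hins, Finset.sum_insert hy'] at h2
      have h3 : ∑ z ∈ Finset.univ.filter (y < ·), (IncidenceAlgebra.mu ℤ z ⊤ : ℚ) =
          ∑ z ∈ Finset.univ.filter (y < ·), w z := by
        refine Finset.sum_congr rfl fun z hz => ?_
        have hz' : y < z := by simpa using hz
        exact ih z hz' (ne_bot_of_gt hz')
      have h4 : (IncidenceAlgebra.mu ℤ y ⊤ : ℚ) +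
          ∑ z ∈ Finset.univ.filter (y < ·), (IncidenceAlgebra.mu ℤ z ⊤ : ℚ) =
          if y = ⊤ then 1 else 0 := by exact_mod_cast congrArg (Int.cast : ℤ → ℚ) h1
      linarith
  rw [IncidenceAlgebra.mu_eq_neg_sum_Ioc_of_ne (𝕜 := ℤ) hP, hIoc]
  push_cast
  simp only [bot_lt_iff_ne_bot]
  congr 1
  exact Finset.sum_congr rfl fun z hz => key z (by simpa using hz)

end Moebius

/-! ### Balanced partitions form an upper set -/

namespace Dowling

section Balanced

variable {n : ℕ} {G H T : Type} [Group G] [Group H]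

open scoped Classical in
/-- In every nonzero block, the images of the labels under `χ` are equidistributed. -/
def Balanced (χ : G →* H) (p : GPrepartition n G) : Prop :=
  ∀ B ∈ p.blocks.parts, ∀ j j' : H,
    (B.filter fun a => χ (p.label a) = j).card = (B.filter fun a => χ (p.label a) = j').card

open scoped Classical in
theorem filter_label_mul (χ : G →* H) {p q : GPrepartition n G} {B : Finset (Fin n)} {g : G}
    (h : ∀ a ∈ B, q.label a = p.label a * g) (j : H) :
    (B.filter fun a => χ (q.label a) = j) = B.filter fun a => χ (p.label a) = j * (χ g)⁻¹ := by
  refine Finset.filter_congr fun a ha => ?_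
  rw [h a ha, map_mul, eq_mul_inv_iff_mul_eq]

theorem Balanced.of_equivalent {χ : G →* H} {p q : GPrepartition n G} (h : Equivalent p q)
    (hp : Balanced χ p) : Balanced χ q := by
  intro B hB j j'
  obtain ⟨g, hg⟩ := h.2.2 B (h.2.1 ▸ hB)
  rw [filter_label_mul χ hg, filter_label_mul χ hg]
  exact hp B (h.2.1 ▸ hB) _ _

theorem Balanced.of_zeroMerge {χ : G →* H} {p q : GPrepartition n G} (h : ZeroMerge p q)
    (hp : Balanced χ p) : Balanced χ q := by
  classical
  obtain ⟨B, hB, h1, h2, h3⟩ := h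
  intro D hD j j'
  have hlab : ∀ j, (D.filter fun a => χ (q.label a) = j) =
      D.filter fun a => χ (p.label a) = j := fun j =>
    Finset.filter_congr fun a ha => by rw [h3 a (q.notMem_zero hD ha)]
  convert hp D (Finset.mem_of_mem_erase (h2 ▸ hD)) j j' using 2
  · convert hlab j
  · convert hlab j'

/-- Twisting `C` by `g` only permutes its label classes by a translation, so they remain equal in
size and are added to the equal classes of `B`. -/
theorem Balanced.of_blockMerge {χ : G →* H} {p q : GPrepartition n G} (h : BlockMerge p q)
    (hp : Balanced χ p) : Balanced χ q := by
  classical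
  obtain ⟨B, hB, C, hC, hBC, g, h1, h2, h3, h4⟩ := h
  have hq : ∀ D ∈ p.blocks.parts, D ≠ C → (∀ a ∈ D, a ∉ q.zero) → ∀ j,
      (D.filter fun a => χ (q.label a) = j) = D.filter fun a => χ (p.label a) = j :=
    fun D hD hDC hz j => Finset.filter_congr fun a ha => by
      rw [h4 a (hz a ha) fun haC => hDC (p.blocks.eq_of_mem_parts hD hC ha haC)]
  intro D hD j j'
  have hD' := hD
  rw [h2, Finset.mem_insert] at hD'
  rcases hD' with rfl | hD'
  · have hdis : Disjoint B C := p.blocks.disjoint hB hC hBC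
    have hcard : ∀ j, ((B ∪ C).filter fun a => χ (q.label a) = j).card =
        (B.filter fun a => χ (p.label a) = j).card +
          (C.filter fun a => χ (p.label a) = j * (χ g)⁻¹).card := by
      intro j
      rw [Finset.filter_union, Finset.card_union_of_disjoint
        (Finset.disjoint_filter_filter hdis),
        hq B hB hBC (fun a ha => q.notMem_zero hD (Finset.mem_union_left _ ha)) j]
      congr 2
      convert filter_label_mul χ h3 j
    have e1 := hp B hB j j'
    have e2 := hp C hC (j * (χ g)⁻¹) (j' * (χ g)⁻¹)
    have e3 := hcard j
    have e4 := hcard j'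
    convert e3.trans ((congrArg₂ (· + ·) ?_ ?_).trans e4.symm)
    · convert e1
    · convert e2
  · simp only [Finset.mem_erase] at hD'
    have hz : ∀ a ∈ D, a ∉ q.zero := fun a ha => q.notMem_zero hD ha
    have e1 := hp D hD'.2.2 j j'
    convert e1 using 2
    · convert hq D hD'.2.2 hD'.1 hz j
    · convert hq D hD'.2.2 hD'.1 hz j'

/-- The `G`-partitions with nonempty zero block and balanced nonzero blocks. -/
def balanced (n : ℕ) (χ : G →* H) : Set (GPartition n G) :=
  {x | ∃ p, mk p = x ∧ p.zero.Nonempty ∧ Balanced χ p}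

theorem mk_mem_balanced {χ : G →* H} {p : GPrepartition n G} :
    mk p ∈ balanced n χ ↔ p.zero.Nonempty ∧ Balanced χ p := by
  constructor
  · rintro ⟨q, hq, h1, h2⟩
    have h := Quotient.exact hq
    exact ⟨h.1 ▸ h1, h2.of_equivalent h⟩
  · exact fun h => ⟨p, rfl, h⟩

/-- Because of this, the elements above a balanced `y` are the same in the subposet and in the whole
Dowling lattice. -/
theorem balanced_of_le {χ : G →* H} {x y : GPartition n G} (h : x ≤ y) (hx : x ∈ balanced n χ) :
    y ∈ balanced n χ := by
  induction h with
  | refl => exact hx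
  | tail _ h ih =>
    obtain ⟨p, q, rfl, rfl, h⟩ := h
    rw [mk_mem_balanced] at ih ⊢
    rcases h with h | h
    · refine ⟨?_, ih.2.of_zeroMerge h⟩
      obtain ⟨B, -, h, -⟩ := h
      exact ih.1.mono (h ▸ Finset.subset_union_left)
    · refine ⟨?_, ih.2.of_blockMerge h⟩
      obtain ⟨B, -, C, -, -, g, h, -⟩ := h
      exact h ▸ ih.1

theorem bot_notMem_balanced {χ : G →* H} : ⊥ ∉ balanced n χ := by
  intro h
  obtain ⟨a, ha⟩ := (mk_mem_balanced.1 h).1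
  exact Finset.notMem_empty a ha

theorem kernel_label {f : Fin n → Option (G × T)} {a : Fin n} {g : G} {s : T}
    (h : f a = some (g, s)) : (kernel f).label a = g := by
  simp [kernel, h]

/-- Reduction of the `G`-coordinate along `χ`. -/
def reduce (χ : G → H) (x : Option (G × T)) : Option (H × T) := x.map (Prod.map χ id)

-- The blocks of the kernel are the preimages of the orbits that are hit, and its labels are
-- `G`-coordinates, so balancedness becomes a condition on the fibre sizes of the reduced function.
open scoped Classical in
theorem mk_kernel_mem_balanced {χ : G →* H} {f : Fin n → Option (G × T)} :
    mk (kernel f) ∈ balanced n χ ↔ (∃ a, f a = none) ∧ ∀ s j j',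
      (Finset.univ.filter fun a => reduce χ (f a) = some (j, s)).card =
        (Finset.univ.filter fun a => reduce χ (f a) = some (j', s)).card := by
  have hf := exact_kernel f
  have key : ∀ B ∈ (kernel f).blocks.parts, ∀ a ∈ B, ∀ g s, f a = some (g, s) → ∀ j,
      (B.filter fun a => χ ((kernel f).label a) = j) =
        Finset.univ.filter fun a => reduce χ (f a) = some (j, s) := by
    intro B hB a ha g s hs j
    ext b
    simp only [Finset.mem_filter, hf.mem_block_iff hB ha, Finset.mem_univ, true_and]
    constructor
    · rintro ⟨⟨g', h, s', h1, h2⟩, rfl⟩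
      rw [hs] at h1
      simp only [Option.some.injEq, Prod.mk.injEq] at h1
      simp [reduce, h2, kernel_label h2, h1.2]
    · intro h
      obtain ⟨⟨g', s'⟩, h1, h2⟩ := Option.map_eq_some_iff.1 h
      simp only [Prod.map_apply, id, Prod.mk.injEq] at h2
      obtain ⟨rfl, rfl⟩ := h2
      exact ⟨⟨g, g', s', hs, h1⟩, by rw [kernel_label h1]⟩
  rw [mk_mem_balanced]
  refine and_congr ?_ ⟨fun h s j j' => ?_, fun h B hB j j' => ?_⟩
  · simp [Finset.Nonempty, mem_kernel_zero]
  · by_cases hs : ∃ a g, f a = some (g, s)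
    · obtain ⟨a, g, hg⟩ := hs
      obtain ⟨B, hB, ha⟩ := (kernel f).exists_block (a := a) (by simp [mem_kernel_zero, hg])
      rw [← key B hB a ha g s hg, ← key B hB a ha g s hg]
      exact h B hB j j'
    · have : ∀ j a, reduce χ (f a) ≠ some (j, s) := by
        intro j a h
        obtain ⟨⟨g', s'⟩, h1, h2⟩ := Option.map_eq_some_iff.1 h
        simp only [Prod.map_apply, id, Prod.mk.injEq] at h2
        exact hs ⟨a, g', h2.2 ▸ h1⟩
      simp [this]
  · obtain ⟨a, ha⟩ := (kernel f).blocks.nonempty_of_mem_parts hB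
    have ha0 : f a ≠ none := fun h => (kernel f).notMem_zero hB ha (mem_kernel_zero.2 h)
    obtain ⟨⟨g, s⟩, hg⟩ := Option.ne_none_iff_exists'.1 ha0
    rw [key B hB a ha g s hg, key B hB a ha g s hg]
    exact h s j j'

end Balanced

end Dowling

/-! ### Counting words with prescribed fibre sizes -/

/-- The power `(∑ x, X_{ρ x}) ^ n` is expanded in two ways: over words, each contributing the
monomial of its fibre sizes, and by the multinomial theorem after grouping letters by `ρ`. The count
is the coefficient of the monomial with exponent `v`. -/
theorem card_words_eq_multinomial {A κ : Type} [Fintype A] [Fintype κ] [DecidableEq κ]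
    (ρ : A → κ) (n : ℕ) (v : κ → ℕ) (hv : ∑ c, v c = n) :
    (Finset.univ.filter fun f : Fin n → A =>
        ∀ c, (Finset.univ.filter fun a => ρ (f a) = c).card = v c).card =
      Nat.multinomial Finset.univ v *
        ∏ c, (Finset.univ.filter fun x => ρ x = c).card ^ v c := by
  classical
  have hcoeff : ∀ u : κ → ℕ, MvPolynomial.coeff (Finsupp.equivFunOnFinite.symm v)
      (∏ c, (MvPolynomial.X c : MvPolynomial κ ℕ) ^ u c) = if u = v then 1 else 0 := by
    intro u
    rw [MvPolynomial.coeff_prod_X_pow]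
    refine if_congr ?_ rfl rfl
    rw [DFunLike.ext_iff, funext_iff]
    simp [eq_comm]
  have h1 : ∑ f : Fin n → A, ∏ a, (MvPolynomial.X (ρ (f a)) : MvPolynomial κ ℕ) =
      ∑ k ∈ Finset.piAntidiag Finset.univ n, (Nat.multinomial Finset.univ k : MvPolynomial κ ℕ) *
        ∏ c, (((Finset.univ.filter fun x => ρ x = c).card : MvPolynomial κ ℕ) *
          MvPolynomial.X c) ^ k c := by
    rw [← Finset.sum_pow_eq_sum_piAntidiag, ← Fintype.sum_pow
      (fun x : A => (MvPolynomial.X (ρ x) : MvPolynomial κ ℕ)) n]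
    congr 1
    rw [← Finset.sum_fiberwise_of_maps_to (t := Finset.univ) (g := ρ) (fun _ _ => Finset.mem_univ _)]
    refine Finset.sum_congr rfl fun c _ => ?_
    rw [Finset.sum_congr rfl fun x hx => congrArg MvPolynomial.X (Finset.mem_filter.1 hx).2,
      Finset.sum_const, nsmul_eq_mul]
  have h2 := congrArg (MvPolynomial.coeff (Finsupp.equivFunOnFinite.symm v)) h1
  rw [MvPolynomial.coeff_sum, MvPolynomial.coeff_sum] at h2
  have h3 : ∀ f : Fin n → A, ∏ a, (MvPolynomial.X (ρ (f a)) : MvPolynomial κ ℕ) =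
      ∏ c, MvPolynomial.X c ^ (Finset.univ.filter fun a => ρ (f a) = c).card := by
    intro f
    rw [← Finset.prod_fiberwise_of_maps_to (t := Finset.univ) (g := fun a => ρ (f a))
      (fun _ _ => Finset.mem_univ _)]
    refine Finset.prod_congr rfl fun c _ => ?_
    rw [Finset.prod_congr rfl fun x hx => congrArg MvPolynomial.X (Finset.mem_filter.1 hx).2,
      Finset.prod_const]
  have h4 : ∀ k : κ → ℕ, (Nat.multinomial Finset.univ k : MvPolynomial κ ℕ) *
      ∏ c, (((Finset.univ.filter fun x => ρ x = c).card : MvPolynomial κ ℕ) *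
        MvPolynomial.X c) ^ k c =
      MvPolynomial.C (Nat.multinomial Finset.univ k *
        ∏ c, (Finset.univ.filter fun x => ρ x = c).card ^ k c) *
        ∏ c, MvPolynomial.X c ^ k c := by
    intro k
    simp only [mul_pow, Finset.prod_mul_distrib, map_mul, map_prod, map_pow, mul_assoc]
    simp
  simp only [h3, h4, MvPolynomial.coeff_C_mul, hcoeff] at h2
  rw [Finset.card_filter]
  simp only [← funext_iff]
  refine h2.trans ?_
  rw [Finset.sum_eq_single v]
  · simp
  · intro k _ hk
    simp [hk]
  · intro h
    exact absurd (Finset.mem_piAntidiag.2 ⟨hv, fun _ _ => Finset.mem_univ _⟩) h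

/-! ### Generating function of functions with balanced kernel -/

namespace Dowling

section Count

variable {n : ℕ} {G H T : Type}

/-- The sizes of the reduced fibres of a balanced function whose zero fibre has size `d * l none`
and whose fibres over `s` have size `l (some s)`. -/
def fiberSize (d : ℕ) (l : Option T → ℕ) : Option (H × T) → ℕ
  | none => d * l none
  | some (_, s) => l (some s)

theorem fiberSize_injective [One H] {d : ℕ} (hd : d ≠ 0) :
    Function.Injective (fiberSize d : (Option T → ℕ) → Option (H × T) → ℕ) := by
  intro l l' h
  funext s
  rcases s with _ | s
  · exact Nat.eq_of_mul_eq_mul_left (Nat.pos_of_ne_zero hd) (congrFun h none)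
  · exact congrFun h (some (1, s))

/-- The exponential generating function of the possible zero blocks. -/
def zeroSeries (d : ℕ) : ℚ⟦X⟧ := PowerSeries.mk fun i => if i = 0 then 0 else 1 / ((d * i)! : ℚ)

/-- The exponential generating function of the balanced functions to one `G`-orbit. -/
def blockSeries (d r : ℕ) : ℚ⟦X⟧ := PowerSeries.mk fun b => ((r : ℚ) ^ b / (b ! : ℚ)) ^ d

variable [Fintype T]

theorem sum_fiberSize [Fintype H] (l : Option T → ℕ) :
    ∑ c, fiberSize (H := H) (Fintype.card H) l c = Fintype.card H * ∑ s, l s := by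
  rw [Fintype.sum_option, Fintype.sum_option, Fintype.sum_prod_type, mul_add]
  simp [fiberSize]

variable [Group G] [Group H] [Fintype G]

open scoped Classical in
theorem card_reduce_fiber (χ : G →* H) {r : ℕ}
    (hr : ∀ j, (Finset.univ.filter fun g => χ g = j).card = r) (j : H) (s : T) :
    (Finset.univ.filter fun x : Option (G × T) => reduce χ x = some (j, s)).card = r := by
  rw [← hr j]
  symm
  refine Finset.card_bij (fun g _ => some (g, s)) ?_ ?_ ?_
  · intro g hg
    simpa [reduce] using hg
  · intro g _ g' _ h
    simpa using h
  · intro x hx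
    obtain ⟨⟨g', s'⟩, h1, h2⟩ := Option.map_eq_some_iff.1 (Finset.mem_filter.1 hx).2
    simp only [Prod.map_apply, id, Prod.mk.injEq] at h2
    obtain ⟨h2, rfl⟩ := h2
    exact ⟨g', by simpa using h2, h1.symm⟩

open scoped Classical in
theorem card_reduce_none (χ : G →* H) :
    (Finset.univ.filter fun x : Option (G × T) => reduce χ x = none).card = 1 := by
  rw [Finset.card_eq_one]
  exact ⟨none, by ext x; simp [reduce]⟩

variable [Fintype H]

open scoped Classical in
theorem filter_kernel_mem_balanced (χ : G →* H) :
    (Finset.univ.filter fun f : Fin (Fintype.card H * n) → Option (G × T) =>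
        mk (kernel f) ∈ balanced _ χ) =
      ((Finset.finsuppAntidiag (Finset.univ : Finset (Option T)) n).filter
          fun l => l none ≠ 0).biUnion fun l =>
        Finset.univ.filter fun f => ∀ c, (Finset.univ.filter fun a => reduce χ (f a) = c).card =
          fiberSize (Fintype.card H) l c := by
  ext f
  simp only [Finset.mem_filter, Finset.mem_univ, true_and, Finset.mem_biUnion,
    mk_kernel_mem_balanced]
  have hnone : ∀ a, reduce χ (f a) = none ↔ f a = none := fun a => by simp [reduce]
  constructor
  · rintro ⟨⟨a, ha⟩, h⟩
    have htot : ∑ c, (Finset.univ.filter fun a => reduce χ (f a) = c).card =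
        Fintype.card H * n := by
      rw [← Finset.card_eq_sum_card_fiberwise fun _ _ => Finset.mem_coe.2 (Finset.mem_univ _)]
      simp
    -- There are `|H| * n` points in all, and each orbit takes `|H|` fibres of equal size, so `|H|`
    -- divides what is left for `none`.
    have hdvd : Fintype.card H ∣ (Finset.univ.filter fun a => reduce χ (f a) = none).card := by
      rw [Fintype.sum_option, Fintype.sum_prod_type_right] at htot
      refine (Nat.dvd_add_left (Finset.dvd_sum fun s _ => ?_)).1 (htot ▸ dvd_mul_right _ n)
      rw [Finset.sum_congr rfl fun j _ => h s j 1]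
      simp
    obtain ⟨k, hk⟩ := hdvd
    let l : Option T → ℕ := fun s => s.elim k fun s =>
      (Finset.univ.filter fun a => reduce χ (f a) = some (1, s)).card
    have hl : ∀ c, (Finset.univ.filter fun a => reduce χ (f a) = c).card =
        fiberSize (Fintype.card H) l c := by
      rintro (_ | ⟨j, s⟩)
      · exact hk
      · exact h s j 1
    refine ⟨Finsupp.equivFunOnFinite.symm l, ⟨?_, ?_⟩, hl⟩
    · rw [Finset.mem_finsuppAntidiag]
      refine ⟨?_, Finset.subset_univ _⟩
      rw [Finset.sum_congr rfl fun c _ => hl c, sum_fiberSize] at htot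
      exact Nat.eq_of_mul_eq_mul_left Fintype.card_pos htot
    · change k ≠ 0
      rintro rfl
      have : a ∈ Finset.univ.filter fun a => reduce χ (f a) = none := by simp [hnone, ha]
      rw [Finset.card_eq_zero.1 hk] at this
      exact Finset.notMem_empty a this
  · rintro ⟨l, ⟨-, hl0⟩, hl⟩
    refine ⟨?_, fun s j j' => by rw [hl, hl]; rfl⟩
    have : (Finset.univ.filter fun a => reduce χ (f a) = none).card ≠ 0 := by
      rw [hl]
      exact mul_ne_zero Fintype.card_ne_zero hl0
    obtain ⟨a, ha⟩ := Finset.card_ne_zero.1 this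
    exact ⟨a, (hnone a).1 (Finset.mem_filter.1 ha).2⟩

-- For fixed fibre sizes `l` there are `(dn)! / ((d * l none)! * ∏ (l s)! ^ d) * ∏ r ^ (d * l s)`
-- functions, since each reduced value over an orbit has `r` lifts. Apart from `(dn)!`, this is a
-- product of one coefficient for the zero block and one for each orbit.
open scoped Classical in
theorem card_kernel_mem_balanced (χ : G →* H) {d r : ℕ} (hd : Fintype.card H = d)
    (hr : ∀ j, (Finset.univ.filter fun g => χ g = j).card = r) :
    ((Finset.univ.filter fun f : Fin (d * n) → Option (G × T) =>
        mk (kernel f) ∈ balanced _ χ).card : ℚ) =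
      (d * n)! * PowerSeries.coeff n
        (zeroSeries d * blockSeries d r ^ Fintype.card T) := by
  subst hd
  have hprod : zeroSeries (Fintype.card H) * blockSeries (Fintype.card H) r ^ Fintype.card T =
      ∏ s : Option T, s.elim (zeroSeries (Fintype.card H))
        fun _ => blockSeries (Fintype.card H) r := by
    rw [Fintype.prod_option]
    simp
  rw [hprod, PowerSeries.coeff_prod, filter_kernel_mem_balanced, Finset.card_biUnion]
  · rw [Nat.cast_sum, Finset.mul_sum, Finset.sum_filter]
    refine Finset.sum_congr rfl fun l hl => ?_
    rw [Fintype.prod_option]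
    split_ifs with h0
    swap
    -- An empty zero block is excluded on the left and contributes nothing on the right,
    -- `zeroSeries` having constant term zero.
    · simp only [not_not] at h0
      simp [h0, zeroSeries]
    have hsum : ∑ c, fiberSize (H := H) (Fintype.card H) l c = Fintype.card H * n := by
      rw [sum_fiberSize]
      exact congrArg _ (Finset.mem_finsuppAntidiag.1 hl).1
    rw [card_words_eq_multinomial _ _ _ hsum]
    have hm := Nat.multinomial_spec Finset.univ (fiberSize (H := H) (Fintype.card H) l)
    rw [hsum] at hm
    rw [Fintype.prod_option, Fintype.prod_prod_type_right] at hm ⊢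
    simp only [card_reduce_fiber χ hr, card_reduce_none, fiberSize, Finset.prod_const,
      Finset.card_univ, one_pow, one_mul] at hm ⊢
    rw [← hm]
    simp only [zeroSeries, blockSeries, Option.elim, PowerSeries.coeff_mk, if_neg h0, div_pow,
      Finset.prod_div_distrib]
    push_cast
    have h1 : ((Fintype.card H * l none)! : ℚ) ≠ 0 := by positivity
    have h2 : (∏ s : T, ((l (some s))! : ℚ) ^ Fintype.card H) ≠ 0 := by positivity
    field_simp
  · intro l _ l' _ hne
    refine Finset.disjoint_left.2 fun f hf hf' => hne ?_
    simp only [Finset.mem_filter, Finset.mem_univ, true_and] at hf hf'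
    exact DFunLike.coe_injective (fiberSize_injective (H := H) Fintype.card_ne_zero
      (funext fun c => (hf c).symm.trans (hf' c)))

end Count

end Dowling

/-! ### Rational powers of series and polynomial dependence on the exponent -/

section SeriesPow

theorem hasSubst_sub_one {f : ℚ⟦X⟧} (hf : PowerSeries.constantCoeff f = 1) :
    PowerSeries.HasSubst (f - 1) :=
  PowerSeries.HasSubst.of_constantCoeff_zero' (by simp [hf])

theorem seriesPow_natCast {f : ℚ⟦X⟧} (hf : PowerSeries.constantCoeff f = 1) (t : ℕ) :
    seriesPow f t = f ^ t := by
  have h := hasSubst_sub_one hf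
  rw [seriesPow, PowerSeries.binomialSeries_nat, ← PowerSeries.coe_substAlgHom h, map_pow, map_add,
    map_one, PowerSeries.coe_substAlgHom h, PowerSeries.subst_X h, add_sub_cancel]

theorem coeff_seriesPow {f : ℚ⟦X⟧} (hf : PowerSeries.constantCoeff f = 1) (α : ℚ) (n : ℕ) :
    PowerSeries.coeff n (seriesPow f α) =
      ∑ k ∈ Finset.range (n + 1), Ring.choose α k * PowerSeries.coeff n ((f - 1) ^ k) := by
  rw [seriesPow, PowerSeries.coeff_subst' (hasSubst_sub_one hf),
    finsum_eq_sum_of_support_subset (s := Finset.range (n + 1))]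
  · simp
  · intro k hk
    by_contra hkn
    refine hk ?_
    -- The series `f - 1` has no constant term, so its powers beyond `n` do not reach degree `n`.
    have h1 : (PowerSeries.X : ℚ⟦X⟧) ^ k ∣ (f - 1) ^ k :=
      pow_dvd_pow_of_dvd (PowerSeries.X_dvd_iff.2 (by simp [hf])) k
    have h2 := PowerSeries.X_pow_dvd_iff.1 h1 n (by simpa using hkn)
    simp [h2]

/-- Only finitely many binomials `Ring.choose α k` enter a given coefficient, and each is a
polynomial in `α`. This permits passing from natural exponents to `-1/(dr)`. -/
theorem exists_polynomial_coeff_mul_seriesPow (e : ℚ⟦X⟧) {f : ℚ⟦X⟧}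
    (hf : PowerSeries.constantCoeff f = 1) (n : ℕ) :
    ∃ p : Polynomial ℚ, ∀ α, PowerSeries.coeff n (e * seriesPow f α) = p.eval α := by
  refine ⟨∑ ij ∈ Finset.HasAntidiagonal.antidiagonal n,
    (Polynomial.C (PowerSeries.coeff ij.1 e) : Polynomial ℚ) *
    ∑ k ∈ Finset.range (ij.2 + 1), Polynomial.C (PowerSeries.coeff ij.2 ((f - 1) ^ k) / (k ! : ℚ)) *
      descPochhammer ℚ k, fun α => ?_⟩
  have hchoose : ∀ k, Ring.choose α k = (descPochhammer ℚ k).eval α / k ! := by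
    intro k
    rw [Ring.choose_eq_smul, ← descPochhammer_map (Int.castRingHom ℚ), Polynomial.eval_map,
      ← Polynomial.eval₂_smulOneHom_eq_smeval, smul_eq_mul, div_eq_inv_mul,
      Subsingleton.elim (Int.castRingHom ℚ) RingHom.smulOneHom]
  rw [PowerSeries.coeff_mul, Polynomial.eval_finsetSum]
  refine Finset.sum_congr rfl fun ij _ => ?_
  rw [Polynomial.eval_mul, Polynomial.eval_C, Polynomial.eval_finsetSum, coeff_seriesPow hf]
  congr 1
  refine Finset.sum_congr rfl fun k _ => ?_
  rw [Polynomial.eval_mul, Polynomial.eval_C, hchoose]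
  ring

end SeriesPow

/-! ### Specialisation to cyclic groups -/

namespace DowlingQ

open Dowling

/-- Reduction modulo `d`, on `ℤ/drℤ` written multiplicatively. -/
def reduction (d r : ℕ) : Multiplicative (ZMod (d * r)) →* Multiplicative (ZMod d) :=
  AddMonoidHom.toMultiplicative (ZMod.castHom (dvd_mul_right d r) (ZMod d)).toAddMonoidHom

theorem reduction_eq_iff {d r : ℕ} [NeZero d] [NeZero r] (g : Multiplicative (ZMod (d * r)))
    (j : ℕ) : reduction d r g = Multiplicative.ofAdd (j : ZMod d) ↔ g.toAdd.val ≡ j [MOD d] := by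
  rw [← ZMod.natCast_eq_natCast_iff, ZMod.natCast_val]
  rfl

theorem exists_natCast (d : ℕ) [NeZero d] (j : Multiplicative (ZMod d)) :
    ∃ k : ℕ, j = Multiplicative.ofAdd (k : ZMod d) :=
  ⟨j.toAdd.val, by rw [ZMod.natCast_zmod_val]; rfl⟩

theorem balanced_reduction_iff {n d r : ℕ} [NeZero d] [NeZero r]
    (p : GPrepartition n (Multiplicative (ZMod (d * r)))) :
    Balanced (reduction d r) p ↔ ∀ B ∈ p.blocks.parts, ∀ j j' : ℕ,
      (B.filter fun a => (p.label a).toAdd.val ≡ j [MOD d]).card =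
        (B.filter fun a => (p.label a).toAdd.val ≡ j' [MOD d]).card := by
  simp only [← reduction_eq_iff]
  constructor
  · intro h B hB j j'
    convert h B hB (Multiplicative.ofAdd (j : ZMod d)) (Multiplicative.ofAdd (j' : ZMod d))
  · intro h B hB j j'
    obtain ⟨k, rfl⟩ := exists_natCast d j
    obtain ⟨k', rfl⟩ := exists_natCast d j'
    convert h B hB k k'

open scoped Classical in
theorem dvd_card_of_balanced {n : ℕ} {G H : Type} [Group G] [Group H] [Fintype H] {χ : G →* H}
    {p : GPrepartition n G} (h : Balanced χ p) {B : Finset (Fin n)} (hB : B ∈ p.blocks.parts) :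
    Fintype.card H ∣ B.card := by
  rw [Finset.card_eq_sum_card_fiberwise (f := fun a => χ (p.label a)) (t := Finset.univ)
    fun _ _ => Finset.mem_coe.2 (Finset.mem_univ _), Finset.sum_congr rfl fun j _ => h B hB j 1]
  simp

/-- Each of the three nested definitions adjoins `⊥`, which is never balanced because its zero block
is empty. The divisibility of block sizes by `d` is implied by equidistribution over the `d`
residues. -/
theorem mem_restricted_and_ne_bot {n d r : ℕ} [NeZero d] [NeZero r] {x : DowlingQ n (d * r)} :
    x ∈ restricted n (d * r) d d {0} ∧ x ≠ ⊥ ↔ x ∈ balanced n (reduction d r) := by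
  constructor
  · rintro ⟨⟨⟨-, p, rfl, hp⟩ | h, q, hq, hq0⟩ | h, hx⟩
    · refine mk_mem_balanced.2 ⟨?_, (balanced_reduction_iff p).2 hp⟩
      have h0 : p.zero = q.zero := (Quotient.exact hq).1.symm
      rw [h0]
      exact Finset.card_ne_zero.1 hq0
    · exact absurd h hx
    · exact absurd h hx
  · rintro ⟨p, rfl, h0, hp⟩
    refine ⟨Or.inl ⟨Or.inl ⟨Or.inl ⟨p, rfl, fun B hB => ?_⟩, p, rfl,
      (balanced_reduction_iff p).1 hp⟩, p, rfl, Finset.card_ne_zero.2 h0⟩, fun h => ?_⟩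
    · simpa using dvd_card_of_balanced hp hB
    · exact bot_notMem_balanced (h ▸ mk_mem_balanced.2 ⟨h0, hp⟩)

/-- The `d` fibres of a surjective homomorphism have equal size and together make up `d * r`
elements. -/
theorem card_reduction_fiber (d r : ℕ) [NeZero d] [NeZero r] (j : Multiplicative (ZMod d)) :
    (Finset.univ.filter fun g => reduction d r g = j).card = r := by
  classical
  have hsurj : Function.Surjective (reduction d r) :=
    ZMod.castHom_surjective (dvd_mul_right d r)
  have h : ∀ j', (Finset.univ.filter fun g => reduction d r g = j').card =
      (Finset.univ.filter fun g => reduction d r g = j).card := fun j' =>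
    MonoidHom.card_fiber_eq_of_mem_range _ (hsurj _) (hsurj _)
  have htot := Finset.card_eq_sum_card_fiberwise (f := reduction d r) (s := Finset.univ)
    (t := Finset.univ) fun _ _ => Finset.mem_coe.2 (Finset.mem_univ _)
  rw [Finset.sum_congr rfl fun j' _ => h j'] at htot
  simp only [Finset.card_univ, Fintype.card_multiplicative, ZMod.card, Finset.sum_const,
    smul_eq_mul] at htot
  exact (Nat.eq_of_mul_eq_mul_left (Nat.pos_of_ne_zero (NeZero.ne d)) htot).symm

open scoped Classical in
theorem posetMoebius_restricted {n d r : ℕ} [NeZero n] [NeZero d] [NeZero r]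
    [Fintype (DowlingQ n (d * r))] :
    (posetMoebius (restricted n (d * r) d d {0}) : ℚ) =
      -∑ z ∈ Finset.univ.filter (· ∈ balanced n (reduction d r)),
        (weight z).eval (-1 / ((d : ℚ) * r)) := by
  have hcard : (Fintype.card (Multiplicative (ZMod (d * r))) : ℚ) = (d : ℚ) * r := by simp
  have hbot : ∀ y : restricted n (d * r) d d {0}, y ≠ ⊥ ↔
      (y : DowlingQ n (d * r)) ∈ balanced n (reduction d r) := fun y => by
    rw [← mem_restricted_and_ne_bot, Ne, ← Subtype.coe_inj]
    exact ⟨fun h => ⟨y.2, h⟩, fun h => h.2⟩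
  have htop : ∀ y : restricted n (d * r) d d {0}, y = ⊤ ↔ (y : DowlingQ n (d * r)) = ⊤ :=
    fun y => Subtype.ext_iff
  -- Any condition that implies balancedness selects the same elements in the subposet and in the
  -- whole lattice.
  have hsub : ∀ q : DowlingQ n (d * r) → Prop, (∀ x, q x → x ∈ balanced n (reduction d r)) →
      ∀ w : DowlingQ n (d * r) → ℚ,
      ∑ z ∈ Finset.univ.filter (fun z : restricted n (d * r) d d {0} => q z), w z =
        ∑ z ∈ Finset.univ.filter q, w z := by
    intro q hq w
    refine Finset.sum_bij (fun z _ => z.1) ?_ ?_ ?_ fun _ _ => rfl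
    · intro z hz
      simpa using hz
    · intro z _ z' _ h
      exact Subtype.ext h
    · intro x hx
      have hx' : q x := by simpa using hx
      exact ⟨⟨x, (mem_restricted_and_ne_bot.2 (hq x hx')).1⟩, by simpa using hx', rfl⟩
  rw [posetMoebius_eq_neg_sum _ ?_ fun z => (weight z.1).eval (-1 / ((d : ℚ) * r))]
  · rw [← hsub _ (fun _ h => h) fun z => (weight z).eval (-1 / ((d : ℚ) * r))]
    simp only [hbot]
  · intro y hy
    rw [hbot] at hy
    have := sum_eval_weight_ge y.1
    rw [hcard, ← hsub _ (fun x hx => balanced_of_le hx hy)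
      fun z => (weight z).eval (-1 / ((d : ℚ) * r))] at this
    simp only [htop]
    exact this
  -- Since `n ≠ 0`, the zero block of `⊤` is nonempty, so `⊤` is balanced and differs from `⊥`.
  · refine fun h => (hbot ⊤).2 ?_ h.symm
    refine mk_mem_balanced.2 ⟨⟨0, Finset.mem_univ _⟩, fun B hB => ?_⟩
    exact absurd hB (Finset.notMem_empty B)

open scoped Classical in
theorem sum_eval_weight_balanced {n d r : ℕ} [NeZero d] [NeZero r]
    [Fintype (DowlingQ (d * n) (d * r))] (t : ℕ) :
    ∑ z ∈ Finset.univ.filter (· ∈ balanced (d * n) (reduction d r)), (weight z).eval (t : ℚ) =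
      (d * n)! * PowerSeries.coeff n (zeroSeries d * blockSeries d r ^ t) := by
  have h1 := sum_card_kernel_eq (T := Fin t)
    (Finset.univ.filter (· ∈ balanced (d * n) (reduction d r)))
  have hH : Fintype.card (Multiplicative (ZMod d)) = d := by simp
  have h2 := card_kernel_mem_balanced (n := n) (T := Fin t) (reduction d r) hH
    fun j => by convert card_reduction_fiber d r j
  simp only [eval_natCast_weight]
  rw [← Nat.cast_sum]
  simp only [Fintype.card_fin] at h1 h2
  rw [h1]
  simp only [Finset.mem_filter, Finset.mem_univ, true_and]
  exact h2

end DowlingQ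

/-! ### The generating function identity -/

theorem mainTheorem10 (d r : ℕ) [NeZero d] [NeZero r] :
    (PowerSeries.mk fun n : ℕ =>
        if n = 0 then 0
        else (posetMoebius (DowlingQ.restricted (d * n) (d * r) d d {0}) : ℚ) *
          ((d : ℚ) ^ n / (((d * n)! : ℚ) * (r : ℚ) ^ ((d - 1) * n)))) =
      -((PowerSeries.mk fun n : ℕ =>
          if n = 0 then 0
          else (d : ℚ) ^ n / (((d * n)! : ℚ) * (r : ℚ) ^ ((d - 1) * n))) *
        seriesPow
          (PowerSeries.mk fun n : ℕ => (d : ℚ) ^ n * (r : ℚ) ^ n / ((n ! : ℚ) ^ d))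
          (-1 / ((d : ℚ) * (r : ℚ)))) := by
  classical
  have hd0 : (d : ℚ) ≠ 0 := NeZero.ne _
  have hr0 : (r : ℚ) ≠ 0 := NeZero.ne _
  have hconst : ∀ n, (d : ℚ) ^ n / (((d * n)! : ℚ) * (r : ℚ) ^ ((d - 1) * n)) =
      ((d : ℚ) / (r : ℚ) ^ (d - 1)) ^ n * (1 / ((d * n)! : ℚ)) := by
    intro n
    rw [div_pow, ← pow_mul]
    field_simp
  have hE : (PowerSeries.mk fun n : ℕ =>
      if n = 0 then 0 else (d : ℚ) ^ n / (((d * n)! : ℚ) * (r : ℚ) ^ ((d - 1) * n))) =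
      PowerSeries.rescale ((d : ℚ) / (r : ℚ) ^ (d - 1)) (Dowling.zeroSeries d) := by
    ext n
    rw [PowerSeries.coeff_rescale, Dowling.zeroSeries, PowerSeries.coeff_mk, PowerSeries.coeff_mk,
      hconst]
    split_ifs <;> simp
  have hF : (PowerSeries.mk fun n : ℕ => (d : ℚ) ^ n * (r : ℚ) ^ n / ((n ! : ℚ) ^ d)) =
      PowerSeries.rescale ((d : ℚ) / (r : ℚ) ^ (d - 1)) (Dowling.blockSeries d r) := by
    ext n
    rw [PowerSeries.coeff_rescale, Dowling.blockSeries, PowerSeries.coeff_mk, PowerSeries.coeff_mk]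
    obtain ⟨k, hk⟩ := Nat.exists_eq_succ_of_ne_zero (NeZero.ne d)
    -- Splitting one factor off the `d`-th power, possible since `d ≥ 1`, lets the rescaling by `d /
    -- r ^ (d - 1)` leave exactly `d ^ n * r ^ n`.
    have hrk : ((r : ℚ) ^ n) ^ d = r ^ n * ((r : ℚ) ^ (d - 1)) ^ n := by
      rw [← pow_mul, ← pow_mul, ← pow_add, hk, Nat.succ_eq_add_one, Nat.add_sub_cancel]
      ring
    rw [div_pow, div_pow, hrk]
    field_simp
  have hF1 : PowerSeries.constantCoeff
      (PowerSeries.mk fun n : ℕ => (d : ℚ) ^ n * (r : ℚ) ^ n / ((n ! : ℚ) ^ d)) = 1 := by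
    rw [← PowerSeries.coeff_zero_eq_constantCoeff_apply]
    simp
  ext n
  rw [map_neg, PowerSeries.coeff_mk]
  split_ifs with hn
  · subst hn
    simp [PowerSeries.coeff_mul]
  · have : NeZero (d * n) := ⟨mul_ne_zero (NeZero.ne d) hn⟩
    let _ := Fintype.ofFinite (DowlingQ (d * n) (d * r))
    obtain ⟨p, hp⟩ := exists_polynomial_coeff_mul_seriesPow (PowerSeries.mk fun n : ℕ =>
      if n = 0 then 0 else (d : ℚ) ^ n / (((d * n)! : ℚ) * (r : ℚ) ^ ((d - 1) * n))) hF1 n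
    -- At each natural `t` both polynomials give the normalised count of functions with balanced
    -- kernel, so they coincide and may be compared at `-1/(dr)`.
    have hpoly : p = Polynomial.C ((d : ℚ) ^ n / (((d * n)! : ℚ) * (r : ℚ) ^ ((d - 1) * n))) *
        ∑ z ∈ Finset.univ.filter (· ∈ Dowling.balanced (d * n) (DowlingQ.reduction d r)),
          Dowling.weight z := by
      refine Dowling.eq_of_eval_natCast_eq fun t => ?_
      rw [← hp, seriesPow_natCast hF1, hE, hF, ← map_pow, ← map_mul, PowerSeries.coeff_rescale,
        Polynomial.eval_mul, Polynomial.eval_C, Polynomial.eval_finsetSum,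
        DowlingQ.sum_eval_weight_balanced, hconst]
      field_simp
    rw [hp, hpoly, Polynomial.eval_mul, Polynomial.eval_C, Polynomial.eval_finsetSum,
      DowlingQ.posetMoebius_restricted]
    ring
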